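/- For $r\ge 3$, an $r$-graph is an $r$-uniform hypergraph. For integers $\ell\ge r\ge 3$ let $\mathcal K_{\ell+1}^r$ be the family of all $r$-graphs $F$ with at most $\binom{\ell+1}{2}$ edges for which there is a set $S$ of $\ell+1$ vertices such that every pair of vertices in $S$ is covered by an edge of $F$. An $r$-graph $\mathcal H$ is $\mathcal K_{\ell+1}^r$-saturated if it contains no copy of a member of $\mathcal K_{\ell+1}^r$, but adding to $\mathcal H$ any $r$-set of its vertices that is not yet an edge creates a copy of a member of $\mathcal K_{\ell+1}^r$. Let $t_r(n,\ell)$ be the number of edges of the complete $\ell$-partite $r$-graph on $n$ vertices in which any two part sizes differ by at most one. **Theorem.** For every integer $\ell\ge 3$ there exist real numbers $c>0$ and $C>0$, depending only on $\ell$, such that for every integer $r$ with $3\le r\le \ell$ there are arbitrarily large integers $n$ for which there exists a $\mathcal K_{\ell+1}^r$-saturated $r$-graph $\mathcal H$ on $n$ vertices with $$|\mathcal H|\ \ge\ t_r(n,\ell)-C\,n^{\,r-1+1/\ell}$$ such that every complete $\ell$-partite subgraph of $\mathcal H$ (with $\ell$ non-empty, pairwise disjoint vertex classes, not necessarily induced)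 has at most $(1-c)n$ vertices in total. -/

import Mathlib

/-- An `r`-graph (`r`-uniform hypergraph, simple and finite) with vertex set `V`. -/
structure RGraph (r : ℕ) (V : Type*) where
  /-- the edges -/
  edges : Finset (Finset V)
  uniform : ∀ e ∈ edges, e.card = r

namespace RGraph

/-- `H` contains a copy of `F`: an injection of the vertices that maps edges of `F` to edges of `H`. -/
def ContainsCopy {r : ℕ} {V W : Type*} (H : RGraph r V) (F : RGraph r W) : Prop :=
  ∃ f : W ↪ V, ∀ e ∈ F.edges, e.map f ∈ H.edges

/-- A family of (finite) `r`-graphs; it suffices to list members with vertex sets `{0, …, m - 1}`. -/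
abbrev Family (r : ℕ) : Type := ∀ m : ℕ, Set (RGraph r (Fin m))

/-- `H` has no member of the family `𝓕` as a subgraph. -/
def IsFree {r : ℕ} {V : Type*} (𝓕 : Family r) (H : RGraph r V) : Prop :=
  ∀ (m : ℕ) (F : RGraph r (Fin m)), F ∈ 𝓕 m → ¬ H.ContainsCopy F

/-- The `r`-graph `H ∪ {E}` for an `r`-set `E`. -/
def addEdge {r : ℕ} {V : Type*} [DecidableEq V] (H : RGraph r V) (E : Finset V)
    (hE : E.card = r) : RGraph r V where
  edges := insert E H.edges
  uniform := by
    intro e he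
    rcases Finset.mem_insert.mp he with rfl | he
    · exact hE
    · exact H.uniform e he

/-- `H` is `𝓕`-saturated: it is `𝓕`-free, and adding any new edge creates a copy of a
member of `𝓕`. -/
def IsSaturated {r : ℕ} {V : Type*} [DecidableEq V] (𝓕 : Family r) (H : RGraph r V) : Prop :=
  IsFree 𝓕 H ∧
    ∀ (E : Finset V) (hE : E.card = r), E ∉ H.edges → ¬ IsFree 𝓕 (H.addEdge E hE)

/-- The family `𝓚_k^r` of all `r`-graphs with at most `k.choose 2` edges such that, for some
`k`-set `S` of vertices, every pair of vertices in `S` is covered by an edge. -/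
def cliqueFamily (k r : ℕ) : Family r := fun m =>
  {F | F.edges.card ≤ k.choose 2 ∧
    ∃ S : Finset (Fin m), S.card = k ∧
      ∀ u ∈ S, ∀ v ∈ S, u ≠ v → ∃ e ∈ F.edges, u ∈ e ∧ v ∈ e}

/-- The edges of the complete `ℓ`-partite `r`-graph with parts `P 0, …, P (ℓ - 1)`: all `r`-sets
of vertices in the union of the parts that meet every part in at most one vertex. -/
def completePartiteEdges {V : Type*} [DecidableEq V] (r : ℕ) {ℓ : ℕ} (P : Fin ℓ → Finset V) :
    Finset (Finset V) :=
  ((Finset.univ.biUnion P).powersetCard r).filter fun e => ∀ i, (e ∩ P i).card ≤ 1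

/-- `H` has a complete `ℓ`-partite subgraph (not required to be induced) with the (pairwise
disjoint, non-empty) vertex classes `P 0, …, P (ℓ - 1)`. -/
def IsCompletePartiteSubgraph {r : ℕ} {V : Type*} [DecidableEq V] (H : RGraph r V) {ℓ : ℕ}
    (P : Fin ℓ → Finset V) : Prop :=
  (∀ i, (P i).Nonempty) ∧ (∀ i j, i ≠ j → Disjoint (P i) (P j)) ∧
    completePartiteEdges r P ⊆ H.edges

end RGraph

/-- `t_r(n, ℓ)`: the number of edges of the generalized Turán graph `T_r(n, ℓ)`, the complete
`ℓ`-partite `r`-graph on `n` vertices whose part sizes differ by at most one; the parts are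
taken to be the residue classes modulo `ℓ` in `{0, …, n - 1}`. -/
def turanEdgeCount (r n ℓ : ℕ) : ℕ :=
  (RGraph.completePartiteEdges r
    fun i : Fin ℓ => (Finset.univ : Finset (Fin n)).filter fun x => x.val % ℓ = i.val).card

/-! Being `cliqueFamily (ℓ + 1) r`-free amounts to having a `K_{ℓ+1}`-free shadow, so the problem
reduces to graphs. Start from a complete `ℓ`-partite graph whose vertices carry codes in
`[t]^(ℓ-1)`, with `t` copies per code and class, and delete the pairs of equal code between the
first two classes. About `ℓt` special vertices, one per digit position and value, make these
deletions permanent: the digits of a code `s` span an `(ℓ-1)`-clique joined to all vertices of code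
`s` in the first two classes, so restoring a deleted pair gives `K_{ℓ+1}`
(`not_adj_of_codeGraph_le`). The graph itself is `K_{ℓ+1}`-free (`codeGraph_cliqueFree`).

Extend its `r`-cliques to a saturated `H`. In a complete `ℓ`-partite subgraph, almost every code
loses its whole group in one of the first two classes, about `t^ℓ ≈ n/ℓ` vertices in total
(`card_biUnion_add_le`). Special vertices and deleted pairs cost only `ℓ t n^(r-1)` edges, where `t
≤ n^(1/ℓ)` (`turanEdgeCount_le`). -/

namespace RGraph

open Finset

/-! ### Shadows, clique hypergraphs and saturation -/

section Shadow

variable {r : ℕ} {V : Type*}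

/-- The shadow graph of an `r`-graph: two vertices are adjacent if some edge covers them. -/
def shadow (H : RGraph r V) : SimpleGraph V where
  Adj u v := u ≠ v ∧ ∃ e ∈ H.edges, u ∈ e ∧ v ∈ e
  symm := ⟨fun _ _ ⟨h, e, he, hu, hv⟩ => ⟨h.symm, e, he, hv, hu⟩⟩
  loopless := ⟨fun _ h => h.1 rfl⟩

theorem shadow_mono {H K : RGraph r V} (h : H.edges ⊆ K.edges) : H.shadow ≤ K.shadow :=
  fun _ _ ⟨hne, e, he, hu, hv⟩ => ⟨hne, e, h he, hu, hv⟩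

theorem isFree_cliqueFamily_of_shadow_cliqueFree {k : ℕ} {H : RGraph r V}
    (h : H.shadow.CliqueFree k) : IsFree (cliqueFamily k r) H := by
  rintro m F ⟨-, S, hS, hcov⟩ ⟨f, hf⟩
  refine h (S.map f) ⟨?_, by simpa using hS⟩
  intro x hx y hy hxy
  simp only [coe_map, Set.mem_image, mem_coe] at hx hy
  obtain ⟨u, hu, rfl⟩ := hx
  obtain ⟨v, hv, rfl⟩ := hy
  obtain ⟨e, he, hue, hve⟩ := hcov u hu v hv (fun h => hxy (by rw [h]))
  exact ⟨hxy, e.map f, hf e he, mem_map_of_mem f hue, mem_map_of_mem f hve⟩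

/-- Choosing one covering edge for each pair of a `k`-clique of the shadow gives at most `k.choose
2` edges, hence a member of the family inside `H`. -/
theorem shadow_cliqueFree_of_isFree {k n : ℕ} {H : RGraph r (Fin n)}
    (h : IsFree (cliqueFamily k r) H) : H.shadow.CliqueFree k := by
  classical
  intro T hT
  have key : ∀ p ∈ T.powersetCard 2, ∃ e ∈ H.edges, p ⊆ e := by
    intro p hp
    obtain ⟨hpT, hp2⟩ := mem_powersetCard.mp hp
    obtain ⟨u, v, huv, rfl⟩ := card_eq_two.mp hp2
    obtain ⟨-, e, he, hu, hv⟩ := hT.isClique (hpT (by simp) : u ∈ T) (hpT (by simp) : v ∈ T) huv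
    exact ⟨e, he, by simp [insert_subset_iff, hu, hv]⟩
  choose! g hgH hg using key
  let F : RGraph r (Fin n) :=
    { edges := (T.powersetCard 2).image g
      uniform := by
        intro e he
        obtain ⟨p, hp, rfl⟩ := mem_image.mp he
        exact H.uniform _ (hgH p hp) }
  refine h n F ⟨?_, T, hT.card_eq, ?_⟩ ⟨.refl _, ?_⟩
  · refine card_image_le.trans ?_
    rw [card_powersetCard, hT.card_eq]
  · intro u hu v hv huv
    have hp : ({u, v} : Finset (Fin n)) ∈ T.powersetCard 2 :=
      mem_powersetCard.mpr ⟨by simp [insert_subset_iff, hu, hv], card_pair huv⟩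
    exact ⟨g {u, v}, mem_image_of_mem _ hp, hg _ hp (by simp), hg _ hp (by simp)⟩
  · intro e he
    obtain ⟨p, hp, rfl⟩ := mem_image.mp he
    simpa using hgH p hp

open Classical in
/-- The `r`-graph whose edges are the `r`-cliques of a graph. -/
noncomputable def ofCliques (r : ℕ) [Fintype V] (G : SimpleGraph V) : RGraph r V where
  edges := univ.filter fun e => G.IsNClique r e
  uniform := fun _ he => (mem_filter.mp he).2.card_eq

theorem mem_ofCliques [Fintype V] {G : SimpleGraph V} {e : Finset V} :
    e ∈ (ofCliques r G).edges ↔ G.IsNClique r e := by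
  simp [ofCliques]

theorem shadow_ofCliques_le [Fintype V] (G : SimpleGraph V) : (ofCliques r G).shadow ≤ G :=
  fun _ _ ⟨hne, _, he, hu, hv⟩ => (mem_ofCliques.mp he).isClique hu hv hne

/-- If every edge of a graph lies in an `l`-clique, it is covered by the `r`-cliques. -/
theorem le_shadow_ofCliques [Fintype V] {G : SimpleGraph V} {l : ℕ} (hr : 2 ≤ r) (hrl : r ≤ l)
    (h : ∀ u v, G.Adj u v → ∃ T, G.IsNClique l T ∧ u ∈ T ∧ v ∈ T) :
    G ≤ (ofCliques r G).shadow := by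
  classical
  intro u v huv
  obtain ⟨T, hT, hu, hv⟩ := h u v huv
  obtain ⟨e, he, heT, hcard⟩ := exists_subsuperset_card_eq (s := {u, v}) (t := T) (n := r)
    (by simp [insert_subset_iff, hu, hv]) (by rwa [card_pair huv.ne]) (by rwa [hT.card_eq])
  exact ⟨huv.ne, e, mem_ofCliques.mpr ⟨hT.isClique.subset (by exact_mod_cast heT), hcard⟩,
    he (by simp), he (by simp)⟩

/-- Every `𝓕`-free `r`-graph on a finite vertex set extends to an `𝓕`-saturated one. -/
theorem exists_isSaturated_of_isFree [Fintype V] [DecidableEq V] {𝓕 : Family r} {H₀ : RGraph r V}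
    (h : IsFree 𝓕 H₀) : ∃ H : RGraph r V, IsSaturated 𝓕 H ∧ H₀.edges ⊆ H.edges := by
  classical
  let A : Finset (Finset (Finset V)) :=
    univ.filter fun E => ∃ H : RGraph r V, H.edges = E ∧ IsFree 𝓕 H ∧ H₀.edges ⊆ H.edges
  obtain ⟨E, hE, hmax⟩ := A.exists_max_image card
    ⟨H₀.edges, mem_filter.mpr ⟨mem_univ _, H₀, rfl, h, Subset.rfl⟩⟩
  obtain ⟨-, H, rfl, hfree, hsub⟩ := mem_filter.mp hE
  refine ⟨H, ⟨hfree, fun E hE hnot hfree' => ?_⟩, hsub⟩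
  have := hmax (insert E H.edges) (mem_filter.mpr ⟨mem_univ _, H.addEdge E hE, rfl, hfree',
    hsub.trans (subset_insert _ _)⟩)
  rw [card_insert_of_notMem hnot] at this
  omega

/-- Vertices in different classes of a complete `l`-partite subgraph are covered by an edge. -/
theorem IsCompletePartiteSubgraph.shadow_adj [DecidableEq V] {H : RGraph r V} {l : ℕ}
    {P : Fin l → Finset V} (hP : H.IsCompletePartiteSubgraph P) (hr : 2 ≤ r) (hrl : r ≤ l)
    {i j : Fin l} (hij : i ≠ j) {u v : V} (hu : u ∈ P i) (hv : v ∈ P j) : H.shadow.Adj u v := by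
  obtain ⟨hne, hdis, hsub⟩ := hP
  choose p hp using hne
  have huv : u ≠ v := fun h => disjoint_left.mp (hdis i j hij) hu (h ▸ hv)
  -- A transversal through `u` and `v`; any `r` of its vertices including both form an edge.
  obtain ⟨q, hq, hqi, hqj⟩ : ∃ q : Fin l → V, (∀ k, q k ∈ P k) ∧ q i = u ∧ q j = v := by
    refine ⟨fun k => if k = i then u else if k = j then v else p k, fun k => ?_, by simp,
      by simp [hij.symm]⟩
    dsimp only
    split_ifs with h1 h2
    · exact h1 ▸ hu
    · exact h2 ▸ hv
    · exact hp k
  have hqk : ∀ k k', q k ∈ P k' → k = k' := fun k k' h => by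
    by_contra hkk
    exact disjoint_left.mp (hdis k k' hkk) (hq k) h
  have hinj : Function.Injective q := fun k k' h => hqk k k' (h ▸ hq k')
  obtain ⟨e, he, heT, hcard⟩ := exists_subsuperset_card_eq (s := {u, v}) (t := univ.image q)
    (n := r) (by
      simp only [insert_subset_iff, singleton_subset_iff, mem_image, mem_univ, true_and]
      exact ⟨⟨i, hqi⟩, ⟨j, hqj⟩⟩) (by rwa [card_pair huv])
    (by rwa [card_image_of_injective _ hinj, card_univ, Fintype.card_fin])
  refine ⟨huv, e, hsub ?_, he (by simp), he (by simp)⟩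
  refine mem_filter.mpr ⟨mem_powersetCard.mpr ⟨fun x hx => ?_, hcard⟩, fun k => ?_⟩
  · obtain ⟨k, -, rfl⟩ := mem_image.mp (heT hx)
    exact mem_biUnion.mpr ⟨k, mem_univ _, hq k⟩
  · refine card_le_one.mpr fun x hx y hy => ?_
    obtain ⟨hxe, hxk⟩ := mem_inter.mp hx
    obtain ⟨hye, hyk⟩ := mem_inter.mp hy
    obtain ⟨a, -, rfl⟩ := mem_image.mp (heT hxe)
    obtain ⟨b, -, rfl⟩ := mem_image.mp (heT hye)
    rw [hqk a k hxk, hqk b k hyk]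

/-- The classes of a complete `l`-partite subgraph are independent in a `K_{l+1}`-free shadow. -/
theorem IsCompletePartiteSubgraph.not_shadow_adj [DecidableEq V] {H : RGraph r V} {l : ℕ}
    {P : Fin l → Finset V} (hP : H.IsCompletePartiteSubgraph P) (hr : 2 ≤ r) (hrl : r ≤ l)
    (hfree : H.shadow.CliqueFree (l + 1)) {i : Fin l} {u v : V} (hu : u ∈ P i) (hv : v ∈ P i) :
    ¬ H.shadow.Adj u v := by
  intro huv
  choose p hp using hP.1
  -- A transversal through `u`, enlarged by `v`, would be an `(l+1)`-clique.
  obtain ⟨q, hq, hqi⟩ : ∃ q : Fin l → V, (∀ k, q k ∈ P k) ∧ q i = u :=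
    ⟨Function.update p i u, fun k => by
      rcases eq_or_ne k i with rfl | h
      · simpa using hu
      · simpa [h] using hp k, by simp⟩
  have hadj : ∀ k k', k ≠ k' → H.shadow.Adj (q k) (q k') := fun k k' h =>
    hP.shadow_adj hr hrl h (hq k) (hq k')
  have hvadj : ∀ k, H.shadow.Adj v (q k) := fun k => by
    rcases eq_or_ne k i with rfl | h
    · rw [hqi]; exact huv.symm
    · exact hP.shadow_adj hr hrl h.symm hv (hq k)
  have hinj : Function.Injective q := fun k k' h => by
    by_contra hk
    exact (hadj k k' hk).ne h
  refine hfree (insert v (univ.image q)) ⟨?_, ?_⟩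
  · rw [coe_insert, SimpleGraph.isClique_insert]
    refine ⟨?_, ?_⟩
    · intro x hx y hy hxy
      obtain ⟨a, -, rfl⟩ := mem_image.mp (mem_coe.mp hx)
      obtain ⟨b, -, rfl⟩ := mem_image.mp (mem_coe.mp hy)
      exact hadj a b fun h => hxy (h ▸ rfl)
    · intro x hx _
      obtain ⟨a, -, rfl⟩ := mem_image.mp (mem_coe.mp hx)
      exact hvadj a
  · rw [card_insert_of_notMem, card_image_of_injective _ hinj, card_univ, Fintype.card_fin]
    rintro hmem
    obtain ⟨a, -, ha⟩ := mem_image.mp hmem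
    exact (hvadj a).ne ha.symm

end Shadow

/-- At most `n ^ (r - |A|)` of the `r`-subsets of an `n`-set contain a given set `A`. -/
theorem card_filter_superset_le {V : Type*} [Fintype V] [DecidableEq V] (r : ℕ) (A : Finset V) :
    ((univ.powersetCard r).filter fun e => A ⊆ e).card ≤ Fintype.card V ^ (r - A.card) := by
  have : ((univ.powersetCard r).filter fun e => A ⊆ e).card
      ≤ ((univ : Finset V).powersetCard (r - A.card)).card := by
    refine card_le_card_of_injOn (fun e => e \ A) ?_ ?_
    · intro e he
      obtain ⟨he, hA⟩ := mem_filter.mp (mem_coe.mp he)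
      have := (mem_powersetCard.mp he).2
      simp [mem_powersetCard, card_sdiff_of_subset hA, this]
    · intro e he e' he' h
      have h1 := (mem_filter.mp (mem_coe.mp he)).2
      have h2 := (mem_filter.mp (mem_coe.mp he')).2
      rw [← sdiff_union_of_subset h1, ← sdiff_union_of_subset h2]
      exact congrArg (· ∪ A) h
  refine this.trans ?_
  rw [card_powersetCard, card_univ]
  exact Nat.choose_le_pow _ _

end RGraph

/-! ### The code graph and its cliques -/

namespace RGraph

open Finset

/-- Vertices of the construction: `inl (i, s, a)` is a vertex with code `s` in the class `i`, and
`inr (j, v)` is the special vertex that stands for the codes with `j`-th digit `v`. -/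
abbrev CodeVertex (l t : ℕ) : Type :=
  (Fin l × (Fin (l - 1) → Fin t) × Fin t) ⊕ (Fin (l - 1) × Fin t)

/-- Adjacency of the construction. -/
def CodeAdj {l t : ℕ} : CodeVertex l t → CodeVertex l t → Prop
  | .inl (i, s, _), .inl (j, s', _) => i ≠ j ∧ ¬ (i.val < 2 ∧ j.val < 2 ∧ s = s')
  | .inl (i, s, _), .inr (j, v) => i.val < 2 ∧ s j = v
  | .inr (j, v), .inl (i, s, _) => i.val < 2 ∧ s j = v
  | .inr (j, _), .inr (j', _) => j ≠ j'

/-- The complete `l`-partite graph with classes `[t]^(l-1) × [t]`, from which the pairs with equal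
codes in the first two classes are removed, together with a complete `(l-1)`-partite graph of
special vertices, each joined to the vertices of the first two classes whose codes have the
given digit. -/
def codeGraph (l t : ℕ) : SimpleGraph (CodeVertex l t) where
  Adj := CodeAdj
  symm := ⟨by
    rintro (⟨i, s, a⟩ | ⟨j, v⟩) (⟨i', s', a'⟩ | ⟨j', v'⟩) h
    · exact ⟨h.1.symm, fun h' => h.2 ⟨h'.2.1, h'.1, h'.2.2.symm⟩⟩
    · exact h
    · exact h
    · exact Ne.symm h⟩
  loopless := ⟨by
    rintro (⟨i, s, a⟩ | ⟨j, v⟩) h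
    · exact h.1 rfl
    · exact h rfl⟩

variable {l t : ℕ}

/-- Without special vertices the graph is `l`-partite. A clique with a special vertex lives in the
first two classes and the `l - 1` special classes; with `l + 1` vertices it meets them all, and its
special vertices force its two code vertices to agree in every digit, so these are not adjacent. -/
theorem codeGraph_cliqueFree (hl : 2 ≤ l) : (codeGraph l t).CliqueFree (l + 1) := by
  classical
  intro T hT
  by_cases hW : ∃ w, Sum.inr w ∈ T
  · obtain ⟨⟨j₀, v₀⟩, hw⟩ := hW
    have hlow : ∀ i s a, Sum.inl (i, s, a) ∈ T → i.val < 2 := fun i s a h =>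
      (hT.isClique h hw (by simp) : CodeAdj _ _).1
    let f : CodeVertex l t → ℕ := fun x => x.elim (fun y => y.1.val) (fun y => y.1.val + 2)
    have hinj : Set.InjOn f T := by
      intro x hx y hy hxy
      by_contra hne
      have hadj : CodeAdj x y := hT.isClique hx hy hne
      rcases x with ⟨i, s, a⟩ | ⟨j, v⟩ <;> rcases y with ⟨i', s', a'⟩ | ⟨j', v'⟩
      · exact hadj.1 (Fin.ext hxy)
      · have := hlow _ _ _ hx
        simp only [f, Sum.elim_inl, Sum.elim_inr] at hxy
        omega
      · have := hlow _ _ _ hy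
        simp only [f, Sum.elim_inl, Sum.elim_inr] at hxy
        omega
      · exact hadj (Fin.ext (by simpa [f] using hxy))
    have himg : T.image f = range (l + 1) := by
      refine eq_of_subset_of_card_le (fun m hm => ?_) ?_
      · obtain ⟨x, -, rfl⟩ := mem_image.mp hm
        rcases x with ⟨i, s, a⟩ | ⟨j, v⟩
        · simp only [f, Sum.elim_inl, mem_range]; omega
        · simp only [f, Sum.elim_inr, mem_range]; omega
      · rw [card_image_of_injOn hinj, hT.card_eq, card_range]
    have hex : ∀ m < l + 1, ∃ x ∈ T, f x = m := fun m hm =>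
      mem_image.mp (himg ▸ mem_range.mpr hm)
    obtain ⟨x, hx, hx0⟩ := hex 0 (by omega)
    obtain ⟨y, hy, hy1⟩ := hex 1 (by omega)
    rcases x with ⟨i, s, a⟩ | ⟨j, v⟩
    swap
    · simp [f] at hx0
    rcases y with ⟨i', s', a'⟩ | ⟨j', v'⟩
    swap
    · simp [f] at hy1
    simp only [f, Sum.elim_inl] at hx0 hy1
    have hii : i ≠ i' := fun h => by rw [h, hy1] at hx0; omega
    have hadj : CodeAdj _ _ := hT.isClique hx hy (by simp [hii])
    refine hadj.2 ⟨by omega, by omega, funext fun j => ?_⟩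
    obtain ⟨z, hz, hzj⟩ := hex (j.val + 2) (by omega)
    rcases z with ⟨i₁, s₁, a₁⟩ | ⟨j₁, v₁⟩
    · have := hlow _ _ _ hz
      simp only [f, Sum.elim_inl] at hzj
      omega
    · have hj : j₁ = j := Fin.ext (by simpa [f] using hzj)
      subst hj
      have h1 : CodeAdj _ _ := hT.isClique hx hz (by simp)
      have h2 : CodeAdj _ _ := hT.isClique hy hz (by simp)
      exact h1.2.trans h2.2.symm
  · have hmem : ∀ x ∈ T, ∃ y, x = Sum.inl y := by
      rintro (y | w) hx
      · exact ⟨y, rfl⟩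
      · exact absurd ⟨w, hx⟩ hW
    have hcard : T.card ≤ (range l).card := by
      refine card_le_card_of_injOn (fun x => x.elim (fun y => y.1.val) fun _ => 0) ?_ ?_
      · intro x hx
        obtain ⟨y, rfl⟩ := hmem x hx
        simp
      · intro x hx x' hx' h
        by_contra hne
        have hadj : CodeAdj x x' := hT.isClique hx hx' hne
        obtain ⟨y, rfl⟩ := hmem x hx
        obtain ⟨y', rfl⟩ := hmem x' hx'
        exact hadj.1 (Fin.ext h)
    rw [hT.card_eq, card_range] at hcard
    omega

/-- The special vertices that stand for the digits of a code. -/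
def digitClique (s : Fin (l - 1) → Fin t) : Finset (CodeVertex l t) :=
  univ.map ⟨fun j => Sum.inr (j, s j), fun j j' h => by
    have := Sum.inr.inj h
    exact (Prod.mk.inj this).1⟩

theorem digitClique_isNClique (s : Fin (l - 1) → Fin t) :
    (codeGraph l t).IsNClique (l - 1) (digitClique s) := by
  refine ⟨?_, by simp [digitClique]⟩
  intro x hx y hy hxy
  simp only [digitClique, coe_map, coe_univ, Set.image_univ, Set.mem_range] at hx hy
  obtain ⟨j, rfl⟩ := hx
  obtain ⟨j', rfl⟩ := hy
  exact fun h => hxy (by rw [h])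

theorem inr_mem_digitClique {s : Fin (l - 1) → Fin t} {j : Fin (l - 1)} {v : Fin t} :
    (Sum.inr (j, v) : CodeVertex l t) ∈ digitClique s ↔ s j = v := by
  simp only [digitClique, mem_map, mem_univ, true_and]
  constructor
  · rintro ⟨k, hk⟩
    obtain ⟨rfl, hv⟩ := Prod.mk.inj (Sum.inr.inj hk)
    exact hv
  · rintro rfl
    exact ⟨j, rfl⟩

theorem adj_of_mem_digitClique {s : Fin (l - 1) → Fin t} {i : Fin l} (hi : i.val < 2) (a : Fin t)
    {x : CodeVertex l t} (hx : x ∈ digitClique s) : (codeGraph l t).Adj (.inl (i, s, a)) x := by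
  simp only [digitClique, mem_map, mem_univ, true_and] at hx
  obtain ⟨j, rfl⟩ := hx
  exact ⟨hi, rfl⟩

theorem insert_digitClique_isNClique (hl : 2 ≤ l) (s : Fin (l - 1) → Fin t) {i : Fin l}
    (hi : i.val < 2) (a : Fin t) :
    (codeGraph l t).IsNClique l (insert (.inl (i, s, a)) (digitClique s)) := by
  have := (digitClique_isNClique (l := l) s).insert (a := .inl (i, s, a))
    fun x hx => adj_of_mem_digitClique hi a hx
  rwa [show l - 1 + 1 = l by omega] at this

theorem exists_isNClique_of_code_ne (c : Fin l → Fin (l - 1) → Fin t) (b : Fin l → Fin t)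
    (hc : ∀ i j : Fin l, i.val < 2 → j.val < 2 → i ≠ j → c i ≠ c j) :
    ∃ T, (codeGraph l t).IsNClique l T ∧ ∀ i, Sum.inl (i, c i, b i) ∈ T := by
  classical
  have hinj : Function.Injective fun i => (Sum.inl (i, c i, b i) : CodeVertex l t) := fun i j h =>
    (Prod.mk.inj (Sum.inl.inj h)).1
  refine ⟨univ.image fun i => Sum.inl (i, c i, b i), ⟨?_, ?_⟩, fun i => ?_⟩
  · intro x hx y hy hxy
    obtain ⟨i, -, rfl⟩ := mem_image.mp (mem_coe.mp hx)
    obtain ⟨j, -, rfl⟩ := mem_image.mp (mem_coe.mp hy)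
    have hij : i ≠ j := fun h => hxy (by rw [h])
    exact ⟨hij, fun h => hc i j h.1 h.2.1 hij h.2.2⟩
  · rw [card_image_of_injective _ hinj, card_univ, Fintype.card_fin]
  · exact mem_image_of_mem _ (mem_univ i)

/-- Needed so that passing to `r`-cliques loses no edge of the graph in the shadow. -/
theorem exists_isNClique_of_codeGraph_adj (hl : 2 ≤ l) (ht : 4 ≤ t) (u v : CodeVertex l t)
    (huv : (codeGraph l t).Adj u v) :
    ∃ T, (codeGraph l t).IsNClique l T ∧ u ∈ T ∧ v ∈ T := by
  classical
  have mixed : ∀ (i : Fin l) s a j w, i.val < 2 → s j = w →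
      ∃ T, (codeGraph l t).IsNClique l T ∧ Sum.inl (i, s, a) ∈ T ∧ Sum.inr (j, w) ∈ T :=
    fun i s a j w hi hs => ⟨_, insert_digitClique_isNClique hl s hi a, mem_insert_self _ _,
      mem_insert_of_mem (inr_mem_digitClique.mpr hs)⟩
  have hadj : CodeAdj u v := huv
  rcases u with ⟨i, s, a⟩ | ⟨j, w⟩ <;> rcases v with ⟨i', s', a'⟩ | ⟨j', w'⟩
  · obtain ⟨hii, hcode⟩ := hadj
    have hcard : 4 ≤ Fintype.card (Fin (l - 1) → Fin t) := by
      rw [Fintype.card_fun, Fintype.card_fin, Fintype.card_fin]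
      exact ht.trans (Nat.le_self_pow (by omega) t)
    have hex : ∀ A : Finset (Fin (l - 1) → Fin t), A.card ≤ 3 → ∃ d, d ∉ A := fun A hA => by
      by_contra! h
      rw [eq_univ_of_forall h, card_univ] at hA
      omega
    -- Fresh codes, `d` for class 0 and `d'` for class 1 where these are not prescribed, so that the
    -- transversal has no equal codes there.
    obtain ⟨d, hd⟩ := hex {s, s'} (card_le_two.trans (by omega))
    obtain ⟨d', hd'⟩ := hex {s, s', d} card_le_three
    simp only [mem_insert, mem_singleton, not_or] at hd hd'
    obtain ⟨T, hT, hmem⟩ := exists_isNClique_of_code_ne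
      (fun k => if k = i then s else if k = i' then s' else if k.val = 0 then d else d')
      (fun k => if k = i then a else a') (by
        intro k k' hk hk' hkk
        have hv : k.val ≠ k'.val := fun h => hkk (Fin.ext h)
        by_cases h1 : k = i <;> by_cases h2 : k = i' <;> by_cases h3 : k' = i <;>
          by_cases h4 : k' = i' <;> by_cases h5 : k.val = 0 <;> by_cases h6 : k'.val = 0 <;>
          simp only [h1, h2, h3, h4, h5, h6, if_true, if_false] <;> grind)
    refine ⟨T, hT, ?_, ?_⟩
    · simpa using hmem i
    · simpa [hii.symm] using hmem i'
  · obtain ⟨hi, hs⟩ := hadj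
    exact mixed i s a j' w' hi hs
  · obtain ⟨hi, hs⟩ := hadj
    obtain ⟨T, hT, h1, h2⟩ := mixed i' s' a' j w hi hs
    exact ⟨T, hT, h2, h1⟩
  · have hjj : j ≠ j' := hadj
    refine ⟨_, insert_digitClique_isNClique hl (fun k => if k = j then w else w')
      (i := ⟨0, by omega⟩) (by simp) w, mem_insert_of_mem (inr_mem_digitClique.mpr (by simp)),
      mem_insert_of_mem (inr_mem_digitClique.mpr (by simp [hjj.symm]))⟩

/-- A `K_{l+1}`-free graph containing the construction has no edge between vertices with equal
codes in the first two classes. -/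
theorem not_adj_of_codeGraph_le {S : SimpleGraph (CodeVertex l t)} (hl : 2 ≤ l)
    (hle : codeGraph l t ≤ S) (hfree : S.CliqueFree (l + 1)) {i j : Fin l} (hi : i.val < 2)
    (hj : j.val < 2) (s : Fin (l - 1) → Fin t) (a b : Fin t) :
    ¬ S.Adj (.inl (i, s, a)) (.inl (j, s, b)) := by
  classical
  intro h
  refine hfree _ (((insert_digitClique_isNClique hl s hj b).mono hle).insert
    (a := .inl (i, s, a)) fun x hx => ?_)
  rcases mem_insert.mp hx with rfl | hx
  · exact h
  · exact hle (adj_of_mem_digitClique hi a hx)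

/-- The vertices of the construction can be numbered so that the classes become residue classes. -/
theorem exists_codeVertex_equiv (l t : ℕ) :
    ∃ f : CodeVertex l t ≃ Fin (t ^ (l - 1) * t * l + (l - 1) * t),
      ∀ i s a, (f (.inl (i, s, a))).val % l = i.val := by
  have g : (Fin (l - 1) → Fin t) × Fin t ≃ Fin (t ^ (l - 1) * t) :=
    Fintype.equivFinOfCardEq (by simp)
  -- The class index becomes the low-order digit in base `l`; special vertices are numbered last.
  refine ⟨(Equiv.sumCongr ((Equiv.prodComm _ _).trans
    ((Equiv.prodCongr g (Equiv.refl _)).trans finProdFinEquiv)) finProdFinEquiv).trans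
    finSumFinEquiv, fun i s a => ?_⟩
  simp [Nat.mod_eq_of_lt]

end RGraph

/-! ### Size of complete partite subgraphs and number of edges -/

namespace RGraph

open Finset

variable {l t : ℕ}

/-- The vertex classes of a complete `l`-partite subgraph of a `K_{l+1}`-free graph containing the
construction miss, for all but at most `l` codes, one of the two groups with this code. -/
theorem card_biUnion_add_le {S : SimpleGraph (CodeVertex l t)} (hl : 2 ≤ l)
    (hle : codeGraph l t ≤ S) (hfree : S.CliqueFree (l + 1))
    (P : Fin l → Finset (CodeVertex l t))
    (hcross : ∀ i j, i ≠ j → ∀ u ∈ P i, ∀ v ∈ P j, S.Adj u v)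
    (hin : ∀ i, ∀ u ∈ P i, ∀ v ∈ P i, ¬ S.Adj u v) :
    (univ.biUnion P).card + t ^ (l - 1) * t ≤ Fintype.card (CodeVertex l t) + l * t := by
  classical
  set U := univ.biUnion P with hU
  let z : Fin l := ⟨0, by omega⟩
  let o : Fin l := ⟨1, by omega⟩
  have hz : z.val < 2 := by simp [z]
  have ho : o.val < 2 := by simp [o]
  have hzo : z ≠ o := by simp [z, o]
  -- Exceptional codes: both groups meet a common class `P i`. Different such codes need different
  -- `i`, since vertices of unequal codes in the first two classes are adjacent while `P i` is
  -- independent.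
  let B : Finset (Fin (l - 1) → Fin t) :=
    univ.filter fun s => ∃ i, (∃ a, Sum.inl (z, s, a) ∈ P i) ∧ ∃ b, Sum.inl (o, s, b) ∈ P i
  have hB : B.card ≤ l := by
    have h : ∀ s ∈ B, ∃ i, (∃ a, Sum.inl (z, s, a) ∈ P i) ∧ ∃ b, Sum.inl (o, s, b) ∈ P i :=
      fun s hs => (mem_filter.mp hs).2
    rcases B.eq_empty_or_nonempty with hB | -
    · simp [hB]
    · have : Nonempty (Fin l) := ⟨z⟩
      choose! i hi using h
      have := card_le_card_of_injOn (s := B) (t := univ) i (fun _ _ => by simp) (by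
        intro s hs s' hs' hss
        by_contra hne
        obtain ⟨a, ha⟩ := (hi s hs).1
        obtain ⟨b, hb⟩ := (hi s' hs').2
        rw [hss] at ha
        refine hin _ _ ha _ hb (hle ?_)
        exact ⟨hzo, fun h => hne h.2.2⟩)
      simpa using this
  have hmiss : ∀ s ∈ Bᶜ, ∃ i : Fin l, ∀ a, Sum.inl (i, s, a) ∉ U := by
    intro s hs
    by_contra! h
    obtain ⟨a, ha⟩ := h z
    obtain ⟨b, hb⟩ := h o
    obtain ⟨i, -, hi⟩ := mem_biUnion.mp ha
    obtain ⟨j, -, hj⟩ := mem_biUnion.mp hb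
    rcases eq_or_ne i j with rfl | hij
    · exact mem_compl.mp hs (mem_filter.mpr ⟨mem_univ _, i, ⟨a, hi⟩, b, hj⟩)
    · exact not_adj_of_codeGraph_le hl hle hfree hz ho s a b (hcross i j hij _ hi _ hj)
  have : Nonempty (Fin l) := ⟨z⟩
  choose! i hi using hmiss
  have hcard := card_le_card_of_injOn (s := Bᶜ ×ˢ (univ : Finset (Fin t))) (t := Uᶜ)
    (fun p => Sum.inl (i p.1, p.1, p.2))
    (fun p hp => by
      simp only [coe_product, Set.mem_prod, mem_coe] at hp
      simpa using hi p.1 hp.1 p.2)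
    (by
      rintro ⟨s, a⟩ - ⟨s', a'⟩ - h
      exact (Prod.mk.inj (Sum.inl.inj h)).2)
  rw [card_product, card_univ, Fintype.card_fin] at hcard
  have hBc : B.card + Bᶜ.card = t ^ (l - 1) := by
    rw [card_add_card_compl, Fintype.card_fun, Fintype.card_fin, Fintype.card_fin]
  have hUc := card_add_card_compl U
  have hBt : B.card * t ≤ l * t := Nat.mul_le_mul_right t hB
  rw [← hBc, add_mul]
  omega

/-- All but few edges of the generalized Turán graph are cliques of the construction. -/
theorem turanEdgeCount_le (hl : 2 ≤ l) {r n : ℕ} (hr : 2 ≤ r) (f : CodeVertex l t ≃ Fin n)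
    (hf : ∀ i s a, (f (.inl (i, s, a))).val % l = i.val) :
    turanEdgeCount r n l ≤
      (ofCliques r ((codeGraph l t).comap f.symm)).edges.card + l * t * n ^ (r - 1) := by
  classical
  let z : Fin l := ⟨0, by omega⟩
  let o : Fin l := ⟨1, by omega⟩
  -- The possible losses: `r`-sets with a special vertex (`A₁`) or with a deleted pair (`A₂`).
  let A₁ : Finset (Finset (Fin n)) := (univ : Finset (Fin (l - 1) × Fin t)).biUnion fun w =>
    (univ.powersetCard r).filter fun e => {f (.inr w)} ⊆ e
  let A₂ : Finset (Finset (Fin n)) :=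
    (univ : Finset (((Fin (l - 1) → Fin t) × Fin t) × Fin t)).biUnion fun p =>
      (univ.powersetCard r).filter fun e =>
        {f (.inl (z, p.1.1, p.1.2)), f (.inl (o, p.1.1, p.2))} ⊆ e
  have hsub : completePartiteEdges r
      (fun i : Fin l => (univ : Finset (Fin n)).filter fun x => x.val % l = i.val) ⊆
      (ofCliques r ((codeGraph l t).comap f.symm)).edges ∪ A₁ ∪ A₂ := by
    intro e he
    obtain ⟨he, hpart⟩ := mem_filter.mp he
    have hcard := (mem_powersetCard.mp he).2
    have heu : e ∈ (univ : Finset (Fin n)).powersetCard r :=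
      mem_powersetCard.mpr ⟨subset_univ _, hcard⟩
    by_cases h1 : e ∈ A₁
    · exact mem_union_left _ (mem_union_right _ h1)
    by_cases h2 : e ∈ A₂
    · exact mem_union_right _ h2
    refine mem_union_left _ (mem_union_left _ (mem_ofCliques.mpr ⟨?_, hcard⟩))
    have hW : ∀ w, f (.inr w) ∉ e := fun w hw =>
      h1 (mem_biUnion.mpr ⟨w, mem_univ _, mem_filter.mpr ⟨heu, by simpa using hw⟩⟩)
    have hbad : ∀ s a b, f (.inl (z, s, a)) ∈ e → f (.inl (o, s, b)) ∈ e → False :=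
      fun s a b ha hb => h2 (mem_biUnion.mpr ⟨((s, a), b), mem_univ _,
        mem_filter.mpr ⟨heu, by simp [insert_subset_iff, ha, hb]⟩⟩)
    intro x hx y hy hxy
    obtain ⟨x, rfl⟩ := f.surjective x
    obtain ⟨y, rfl⟩ := f.surjective y
    rcases x with ⟨i, s, a⟩ | w
    swap
    · exact absurd hx (hW w)
    rcases y with ⟨j, s', b⟩ | w
    swap
    · exact absurd hy (hW w)
    rw [SimpleGraph.comap_adj, Equiv.symm_apply_apply, Equiv.symm_apply_apply]
    have hij : i ≠ j := by
      rintro rfl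
      exact hxy (card_le_one.mp (hpart i) _ (mem_inter.mpr ⟨hx, by simp [hf]⟩) _
        (mem_inter.mpr ⟨hy, by simp [hf]⟩))
    refine ⟨hij, ?_⟩
    rintro ⟨hi, hj, rfl⟩
    have hv : i.val ≠ j.val := fun h => hij (Fin.ext h)
    have hcases : (i = z ∧ j = o) ∨ (i = o ∧ j = z) := by
      simp only [Fin.ext_iff, z, o]
      omega
    rcases hcases with ⟨rfl, rfl⟩ | ⟨rfl, rfl⟩
    · exact hbad s a b hx hy
    · exact hbad s b a hy hx
  have hA₁ : A₁.card ≤ (l - 1) * t * n ^ (r - 1) := by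
    refine (card_biUnion_le_card_mul _ _ (n ^ (r - 1)) fun w _ => ?_).trans (by simp)
    refine (card_filter_superset_le r _).trans (by simp)
  have hA₂ : A₂.card ≤ t ^ (l - 1) * t * t * n ^ (r - 2) := by
    refine (card_biUnion_le_card_mul _ _ (n ^ (r - 2)) fun p _ => ?_).trans (by simp)
    refine (card_filter_superset_le r _).trans ?_
    rw [card_pair (by simp [z, o]), Fintype.card_fin]
  have hn : t ^ (l - 1) * t ≤ n := by
    have h := Fintype.card_congr f
    simp only [Fintype.card_sum, Fintype.card_prod, Fintype.card_fun, Fintype.card_fin] at h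
    rw [← h]
    exact (Nat.le_mul_of_pos_left _ (by omega)).trans (Nat.le_add_right _ _)
  -- There are `t^l * t` deleted pairs, and `t^l ≤ n` absorbs one power of `n`.
  have hA₂' : A₂.card ≤ t * n ^ (r - 1) := by
    calc A₂.card ≤ t ^ (l - 1) * t * t * n ^ (r - 2) := hA₂
      _ ≤ n * t * n ^ (r - 2) := by gcongr
      _ = t * n ^ (r - 2 + 1) := by ring
      _ = t * n ^ (r - 1) := by rw [show r - 2 + 1 = r - 1 by omega]
  have hsum : (l - 1) * t * n ^ (r - 1) + t * n ^ (r - 1) = l * t * n ^ (r - 1) := by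
    obtain ⟨k, rfl⟩ : ∃ k, l = k + 1 := ⟨l - 1, by omega⟩
    rw [Nat.add_sub_cancel]
    ring
  have h3 := card_le_card hsub
  have h4 := card_union_le ((ofCliques r ((codeGraph l t).comap f.symm)).edges ∪ A₁) A₂
  have h5 := card_union_le (ofCliques r ((codeGraph l t).comap f.symm)).edges A₁
  unfold turanEdgeCount
  omega

/-- A saturated `r`-graph that contains the cliques of the construction. -/
theorem exists_isSaturated_codeGraph_le_shadow (hl : 2 ≤ l) (ht : 4 ≤ t) {r n : ℕ} (hr : 2 ≤ r)
    (hrl : r ≤ l) (f : CodeVertex l t ≃ Fin n) :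
    ∃ H : RGraph r (Fin n), IsSaturated (cliqueFamily (l + 1) r) H ∧
      (ofCliques r ((codeGraph l t).comap f.symm)).edges ⊆ H.edges ∧
      codeGraph l t ≤ H.shadow.comap f := by
  classical
  set G := (codeGraph l t).comap f.symm with hG
  have hGfree : G.CliqueFree (l + 1) :=
    SimpleGraph.CliqueFree.comap ⟨(SimpleGraph.Embedding.comap f.symm.toEmbedding _).toCopy⟩
      (codeGraph_cliqueFree hl)
  obtain ⟨H, hsat, hsub⟩ := exists_isSaturated_of_isFree
    (isFree_cliqueFamily_of_shadow_cliqueFree (hGfree.anti (shadow_ofCliques_le (r := r) G)))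
  refine ⟨H, hsat, hsub, ?_⟩
  have hcover : G ≤ (ofCliques r G).shadow := by
    refine le_shadow_ofCliques hr hrl fun u v huv => ?_
    obtain ⟨T, hT, hu, hv⟩ := exists_isNClique_of_codeGraph_adj hl ht _ _ huv
    refine ⟨T.map f.toEmbedding, ⟨?_, by simpa using hT.card_eq⟩, ?_, ?_⟩
    · intro x hx y hy hxy
      simp only [coe_map, Set.mem_image, mem_coe] at hx hy
      obtain ⟨x, hx, rfl⟩ := hx
      obtain ⟨y, hy, rfl⟩ := hy
      simpa [hG] using hT.isClique hx hy (fun h => hxy (by rw [h]))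
    · exact mem_map.mpr ⟨_, hu, by simp⟩
    · exact mem_map.mpr ⟨_, hv, by simp⟩
  intro x y hxy
  exact (hcover.trans (shadow_mono hsub)) (show G.Adj (f x) (f y) by simpa [hG] using hxy)

/-- A complete `l`-partite subgraph of an `r`-graph whose shadow contains the construction. -/
theorem IsCompletePartiteSubgraph.card_biUnion_add_le {r n : ℕ} {H : RGraph r (Fin n)}
    {P : Fin l → Finset (Fin n)} (hP : H.IsCompletePartiteSubgraph P) (hl : 2 ≤ l) (hr : 2 ≤ r)
    (hrl : r ≤ l) (hfree : IsFree (cliqueFamily (l + 1) r) H) (f : CodeVertex l t ≃ Fin n)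
    (hle : codeGraph l t ≤ H.shadow.comap f) :
    (univ.biUnion P).card + t ^ (l - 1) * t ≤ n + l * t := by
  classical
  have hsh := shadow_cliqueFree_of_isFree hfree
  have hmem : ∀ i x, x ∈ (P i).map f.symm.toEmbedding → f x ∈ P i := fun i x hx => by
    obtain ⟨y, hy, rfl⟩ := mem_map.mp hx
    simpa using hy
  have := RGraph.card_biUnion_add_le hl hle
    (SimpleGraph.CliqueFree.comap ⟨(SimpleGraph.Embedding.comap f.toEmbedding _).toCopy⟩ hsh)
    (fun i => (P i).map f.symm.toEmbedding)
    (fun i j hij u hu v hv => hP.shadow_adj hr hrl hij (hmem i u hu) (hmem j v hv))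
    (fun i u hu v hv => hP.not_shadow_adj hr hrl hsh (hmem i u hu) (hmem i v hv))
  rw [Fintype.card_congr f, Fintype.card_fin] at this
  rwa [show (univ.biUnion fun i => (P i).map f.symm.toEmbedding) =
    (univ.biUnion P).map f.symm.toEmbedding by ext; simp, card_map] at this

end RGraph

/-! ### Choice of parameters -/

theorem mainTheorem2 (ℓ : ℕ) (hℓ : 3 ≤ ℓ) :
    ∃ c : ℝ, 0 < c ∧ ∃ C : ℝ, 0 < C ∧
      ∀ r : ℕ, 3 ≤ r → r ≤ ℓ →
        ∀ N : ℕ, ∃ n : ℕ, N ≤ n ∧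
          ∃ H : RGraph r (Fin n),
            RGraph.IsSaturated (RGraph.cliqueFamily (ℓ + 1) r) H ∧
            (turanEdgeCount r n ℓ : ℝ) - C * (n : ℝ) ^ ((r : ℝ) - 1 + 1 / (ℓ : ℝ))
              ≤ (H.edges.card : ℝ) ∧
            ∀ P : Fin ℓ → Finset (Fin n), H.IsCompletePartiteSubgraph P →
              ((Finset.univ.biUnion P).card : ℝ) ≤ (1 - c) * (n : ℝ) := by
  have hℓ0 : (0 : ℝ) < ℓ := by exact_mod_cast (by omega : 0 < ℓ)
  -- At least `t^ℓ - ℓt ≥ t^ℓ/2` vertices are missed and `n ≤ 2ℓt^ℓ`, whence `1/(4ℓ)`. The first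
  -- bound uses `t ≥ 2ℓ`.
  refine ⟨1 / (4 * ℓ), by positivity, ℓ, hℓ0, fun r hr hrl N => ?_⟩
  obtain ⟨t, htN, htℓ⟩ : ∃ t, N ≤ t ∧ 2 * ℓ ≤ t := ⟨max N (2 * ℓ), le_max_left _ _, le_max_right _ _⟩
  obtain ⟨n, hn, f, hf⟩ : ∃ n, n = t ^ (ℓ - 1) * t * ℓ + (ℓ - 1) * t ∧
      ∃ f : RGraph.CodeVertex ℓ t ≃ Fin n, ∀ i s a, (f (.inl (i, s, a))).val % ℓ = i.val :=
    ⟨_, rfl, RGraph.exists_codeVertex_equiv ℓ t⟩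
  have hpow : t ^ ℓ = t ^ (ℓ - 1) * t := by rw [← pow_succ]; congr 1; omega
  have hsq : t * t ≤ t ^ ℓ := by
    rw [← pow_two]; exact Nat.pow_le_pow_right (by omega) (by omega)
  have htn : t ^ ℓ ≤ n := by
    rw [hn, ← hpow]
    exact (Nat.le_mul_of_pos_right _ (by omega)).trans (Nat.le_add_right _ _)
  obtain ⟨H, hsat, hsub, hle⟩ := RGraph.exists_isSaturated_codeGraph_le_shadow (l := ℓ) (t := t)
    (by omega) (by omega) (r := r) (by omega) hrl f
  refine ⟨n, htN.trans ((Nat.le_self_pow (by omega) t).trans htn), H, hsat, ?_, fun P hP => ?_⟩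
  · have h1 := RGraph.turanEdgeCount_le (by omega) (by omega : 2 ≤ r) f hf
    have h2 : turanEdgeCount r n ℓ ≤ H.edges.card + ℓ * t * n ^ (r - 1) :=
      h1.trans (Nat.add_le_add_right (Finset.card_le_card hsub) _)
    have hn0 : (0 : ℝ) < n := by
      have : 0 < n := lt_of_lt_of_le (pow_pos (by omega) _) htn
      exact_mod_cast this
    have ht : (t : ℝ) ≤ (n : ℝ) ^ (1 / (ℓ : ℝ)) := by
      rw [one_div, Real.le_rpow_inv_iff_of_pos (by positivity) hn0.le hℓ0, Real.rpow_natCast]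
      exact_mod_cast htn
    have hr1 : (n : ℝ) ^ ((r : ℝ) - 1) = (n : ℝ) ^ (r - 1) := by
      rw [← Real.rpow_natCast, Nat.cast_sub (by omega), Nat.cast_one]
    rw [Real.rpow_add hn0, hr1, sub_le_iff_le_add]
    calc (turanEdgeCount r n ℓ : ℝ) ≤ H.edges.card + ℓ * t * n ^ (r - 1) := by exact_mod_cast h2
      _ ≤ H.edges.card + ℓ * (n : ℝ) ^ (1 / (ℓ : ℝ)) * n ^ (r - 1) := by gcongr
      _ = _ := by ring
  · have h := hP.card_biUnion_add_le (by omega) (by omega) hrl hsat.1 f hle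
    rw [← hpow] at h
    have h1 : 2 * (ℓ * t) ≤ t ^ ℓ := by
      refine le_trans ?_ hsq
      rw [← mul_assoc]
      exact Nat.mul_le_mul_right t htℓ
    have h2 : n ≤ 2 * ℓ * t ^ ℓ := by
      have h3 : (ℓ - 1) * t ≤ ℓ * t := Nat.mul_le_mul_right t (Nat.sub_le _ _)
      have h4 : t ^ ℓ ≤ ℓ * t ^ ℓ := Nat.le_mul_of_pos_left _ (by omega)
      rw [hn, ← hpow, mul_comm (t ^ ℓ) ℓ, mul_assoc 2]
      omega
    have h5 : ((Finset.univ.biUnion P).card : ℝ) + t ^ ℓ / 2 ≤ n := by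
      have : 2 * (Finset.univ.biUnion P).card + t ^ ℓ ≤ 2 * n := by omega
      have : (2 : ℝ) * (Finset.univ.biUnion P).card + t ^ ℓ ≤ 2 * n := by exact_mod_cast this
      linarith
    have h6 : 1 / (4 * (ℓ : ℝ)) * n ≤ t ^ ℓ / 2 := by
      have : (n : ℝ) ≤ 2 * ℓ * t ^ ℓ := by exact_mod_cast h2
      rw [one_div_mul_eq_div, div_le_iff₀ (by positivity)]
      linarith
    linarith
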